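/- Let $G$ be a finite undirected weighted multigraph with vertex set $V=\{1,\dots,n\}$ (parallel edges and loops are allowed) in which every edge has a strictly positive weight. For vertices $i,j$ let $\varepsilon_{ij}$ be the total weight of the edges with ends $i$ and $j$ (zero if there are none). Let $L=L(G)=(\ell_{ij})$ be the Laplacian matrix: $\ell_{ij}=-\varepsilon_{ij}$ for $j\ne i$ and $\ell_{ii}=\sum_{j\ne i}\varepsilon_{ij}$. Paths have no repeated vertices, and the path of length $0$ from a vertex to itself is counted as a path. Then the matrix $I+L$ is invertible, and the matrix $P=P(G)=(p_{ij})=(I+L)^{-1}$ of relative forest accessibilities has the following properties. **Symmetry.** $p_{ij}=p_{ji}$ for all $i,j$. **Nonnegativity.** $p_{ij}\ge 0$ for all $i,j$. **Diagonal maximality.** If $i\ne j$, then $p_{ii}>p_{ij}$ and $p_{ii}>p_{ji}$. **Triangle inequality for proximities.** $p_{ij}+p_{ik}-p_{jk}\le p_{ii}$ for all $i,j,k$; if, in addition, $j=k$ and $i\ne j$, then the inequality is strict. **Disconnection condition.** For all $i,j$, $p_{ij}=0$ if and only if there is no path from $i$ to $j$ in $G$. **Transit property.** If $G$ contains a path from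 $i$ to $k$, $i\ne k\ne t$, and each path from $i$ to $t$ includes $k$, then $p_{ik}>p_{it}$. **Monotonicity.** Let $k\ne t$, let $G'$ be obtained from $G$ either by increasing the weight of one edge with ends $k$ and $t$ or by adding one new edge (of positive weight) with ends $k$ and $t$, and let $\Delta p_{ij}=p_{ij}(G')-p_{ij}(G)$. Then: (1) $\Delta p_{kt}>0$, and $\Delta p_{kt}>\Delta p_{ij}$ for all $i,j$ with $\{i,j\}\ne\{k,t\}$; (2) for every $i$, if there is a path in $G$ from $i$ to $k$ and each path in $G$ from $i$ to $t$ includes $k$, then $\Delta p_{it}>\Delta p_{ik}$; (3) for all $i_1,i_2$, if both $i=i_1$ and $i=i_2$ satisfy the hypothesis of (2), then $p_{i_1i_2}$ does not increase, that is, $\Delta p_{i_1i_2}\le 0$. **Doubly stochastic normalization.** $p_{ij}\ge 0$ for all $i,j$, and $\sum_{j=1}^n p_{ij}=\sum_{j=1}^n p_{ji}=1$ for every $i$. **Macrovertex independence.** Let $D\subseteq V$ be a macrovertex in $G$, that is, $\varepsilon_{ik}=\varepsilon_{jk}$ for all $i,j\in D$ and $k\notin D$. Then for all $i,j\in D$ and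 $k\notin D$, $p_{ik}=p_{jk}$, and $p_{ik}$ does not vary when any new edges with both ends in $D$ are added and the (positive) weights of any existing edges with both ends in $D$ are changed. -/

import Mathlib

noncomputable section

/-- A weighted multigraph whose vertices are all the elements of `V`: an undirected multigraph
(parallel edges and loops are allowed) with finitely many edges, each of which has a strictly
positive weight. The edges are taken from an ambient type `β`; the value of `weight` at
elements of `β` that are not edges is irrelevant. -/
structure WeightedMultigraph (V β : Type*) where
  /-- the underlying multigraph -/
  graph : Graph V β
  vertexSet_eq : graph.vertexSet = Set.univ
  edgeSet_finite : graph.edgeSet.Finite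
  /-- the edge weights -/
  weight : β → ℝ
  weight_pos : ∀ e ∈ graph.edgeSet, 0 < weight e

namespace WeightedMultigraph

/-- `G.IsWalk i j l`: there is a walk in `G` from `i` to `j` along edges of `G`, whose successive
vertices (both ends included) form the list `l`. -/
inductive IsWalk {V β : Type*} (G : WeightedMultigraph V β) : V → V → List V → Prop
  | nil (i : V) : IsWalk G i i [i]
  | cons {e : β} {i j k : V} {l : List V} (he : G.graph.IsLink e i j) (h : IsWalk G j k l) :
      IsWalk G i k (i :: l)

/-- `G.IsPath i j l`: there is a path (a walk without repeated vertices) in `G` from `i` to `j`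
whose successive vertices form the list `l`. The path of length `0` from `i` to `i` has the
vertex list `[i]`. -/
def IsPath {V β : Type*} (G : WeightedMultigraph V β) (i j : V) (l : List V) : Prop :=
  G.IsWalk i j l ∧ l.Nodup

open scoped Classical in
/-- The total weight `ε_{ij}` of the edges with ends `i` and `j`. -/
def totalWeight {V β : Type*} (G : WeightedMultigraph V β) (i j : V) : ℝ :=
  ∑ e ∈ G.edgeSet_finite.toFinset with G.graph.IsLink e i j, G.weight e

/-- The Laplacian (Kirchhoff) matrix of a weighted multigraph: `ℓ_{ij} = -ε_{ij}` for `j ≠ i`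
and `ℓ_{ii} = ∑_{j ≠ i} ε_{ij}`. -/
def laplacian {V β : Type*} [Fintype V] [DecidableEq V] (G : WeightedMultigraph V β) :
    Matrix V V ℝ :=
  Matrix.of fun i j =>
    if i = j then ∑ k ∈ Finset.univ.erase i, G.totalWeight i k else -G.totalWeight i j

/-- The matrix `(I + L(G))⁻¹` of relative forest accessibilities. -/
def forestAccess {V β : Type*} [Fintype V] [DecidableEq V] (G : WeightedMultigraph V β) :
    Matrix V V ℝ :=
  (1 + G.laplacian)⁻¹

/-- `G'` is obtained from `G` by increasing the weight of one existing edge with ends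
`k` and `t`. -/
def WeightIncreased {V β : Type*} (G G' : WeightedMultigraph V β) (k t : V) : Prop :=
  ∃ e, G.graph.IsLink e k t ∧ G'.graph = G.graph ∧ G.weight e < G'.weight e ∧
    ∀ f ∈ G.graph.edgeSet, f ≠ e → G'.weight f = G.weight f

/-- `G'` is obtained from `G` by adding one new edge (of some positive weight) with ends
`k` and `t`. -/
def EdgeAdded {V β : Type*} (G G' : WeightedMultigraph V β) (k t : V) : Prop :=
  ∃ e, e ∉ G.graph.edgeSet ∧
    (∀ f x y, G'.graph.IsLink f x y ↔
      G.graph.IsLink f x y ∨ (f = e ∧ ((x = k ∧ y = t) ∨ (x = t ∧ y = k)))) ∧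
    ∀ f ∈ G.graph.edgeSet, G'.weight f = G.weight f

/-- `D` is a macrovertex in `G`: every vertex outside `D` is joined to all the vertices of `D`
with the same total weight. -/
def IsMacrovertex {V β : Type*} (G : WeightedMultigraph V β) (D : Set V) : Prop :=
  ∀ i ∈ D, ∀ j ∈ D, ∀ k ∉ D, G.totalWeight i k = G.totalWeight j k

/-- `G'` is obtained from `G` by adding any new edges with both ends in `D` and by changing in
any way the (positive) weights of existing edges with both ends in `D`. -/
def ModifiedInside {V β : Type*} (G G' : WeightedMultigraph V β) (D : Set V) : Prop :=
  (∀ e x y, G.graph.IsLink e x y → G'.graph.IsLink e x y) ∧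
  (∀ e x y, G'.graph.IsLink e x y → e ∉ G.graph.edgeSet → x ∈ D ∧ y ∈ D) ∧
  (∀ e x y, G.graph.IsLink e x y → ¬ (x ∈ D ∧ y ∈ D) → G'.weight e = G.weight e)

end WeightedMultigraph

end

/-! Since `((I + L) f) i = f i + ∑ x, ε i x * (f i - f x)`, a function with `(I + L) f ≤ 0` at a
local maximum is nonpositive there. This maximum principle (`nonpos_on`, `lt_of_mulVec_nonpos`)
makes `I + L` injective. Column `j` of `P` solves `(I + L) f = e_j`, so suitable vertex sets give
nonnegativity, diagonal maximality, disconnection and transit; a difference of two columns gives the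
triangle inequality. Row sums are `1` because `I + L` fixes constants.

For monotonicity, `I + L` gains `δ u uᵀ` with `u = e_k - e_t`, so `ΔP = -c p pᵀ` with `p = P u` and
`c > 0`. All three items follow from the signs of `p`, its strict maximum at `k` and its strict
minimum at `t`. For a macrovertex `D`, a column indexed outside `D` is constant on `D`, hence
unaffected by edges inside `D`. -/

namespace WeightedMultigraph

/-! ### Walks, paths and total edge weights -/

section Graphs

variable {V β : Type*} {G : WeightedMultigraph V β}

theorem IsWalk.exists_suffix {i j : V} {l : List V} (h : G.IsWalk i j l) {x : V} (hx : x ∈ l) :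
    ∃ l', G.IsWalk x j l' ∧ l'.Sublist l := by
  induction h with
  | nil i =>
    obtain rfl : x = i := by simpa using hx
    exact ⟨_, .nil x, List.Sublist.refl _⟩
  | @cons e i j k l he h ih =>
    rcases List.mem_cons.1 hx with rfl | hx
    · exact ⟨_, .cons he h, List.Sublist.refl _⟩
    · obtain ⟨l', h1, h2⟩ := ih hx
      exact ⟨l', h1, h2.cons _⟩

/-- Allows arguments with walks, which extend freely by an edge; the inclusion keeps track of
avoided vertices. -/
theorem IsWalk.exists_isPath {i j : V} {l : List V} (h : G.IsWalk i j l) :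
    ∃ l', G.IsPath i j l' ∧ l' ⊆ l := by
  induction h with
  | nil i => exact ⟨[i], ⟨.nil i, by simp⟩, fun _ h => h⟩
  | @cons e i j k l he h ih =>
    obtain ⟨l', ⟨h1, h2⟩, h3⟩ := ih
    by_cases hi : i ∈ l'
    · obtain ⟨l'', h4, h5⟩ := h1.exists_suffix hi
      exact ⟨l'', ⟨h4, h5.nodup h2⟩, fun x hx => List.mem_cons_of_mem _ (h3 (h5.subset hx))⟩
    · exact ⟨i :: l', ⟨.cons he h1, List.nodup_cons.2 ⟨hi, h2⟩⟩, List.cons_subset_cons _ h3⟩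

theorem totalWeight_comm (G : WeightedMultigraph V β) (i j : V) :
    G.totalWeight i j = G.totalWeight j i := by
  classical
  unfold totalWeight
  refine Finset.sum_congr (Finset.filter_congr fun e _ => Graph.isLink_comm) fun _ _ => rfl

theorem totalWeight_nonneg (G : WeightedMultigraph V β) (i j : V) : 0 ≤ G.totalWeight i j := by
  classical
  refine Finset.sum_nonneg fun e he => (G.weight_pos e ?_).le
  simpa using (Finset.mem_filter.1 he).1

theorem totalWeight_pos {e : β} {i j : V} (h : G.graph.IsLink e i j) :
    0 < G.totalWeight i j := by
  classical
  refine Finset.sum_pos (fun e he => G.weight_pos e ?_) ⟨e, ?_⟩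
  · simpa using (Finset.mem_filter.1 he).1
  · simpa [h] using h.edge_mem

theorem exists_isLink {i j : V} (h : G.totalWeight i j ≠ 0) : ∃ e, G.graph.IsLink e i j := by
  classical
  obtain ⟨e, he, -⟩ := Finset.exists_ne_zero_of_sum_ne_zero h
  exact ⟨e, (Finset.mem_filter.1 he).2⟩

theorem WeightIncreased.exists_totalWeight [DecidableEq V] {G' : WeightedMultigraph V β} {k t : V}
    (h : G.WeightIncreased G' k t) : ∃ δ, 0 < δ ∧ ∀ x y, G'.totalWeight x y =
      G.totalWeight x y + if (x = k ∧ y = t) ∨ (x = t ∧ y = k) then δ else 0 := by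
  classical
  obtain ⟨e, he, hg, hlt, hw⟩ := h
  refine ⟨G'.weight e - G.weight e, sub_pos.2 hlt, fun x y => ?_⟩
  have h1 : G'.totalWeight x y = ∑ f ∈ G.edgeSet_finite.toFinset with G.graph.IsLink f x y,
      (G.weight f + if f = e then G'.weight e - G.weight e else 0) := by
    unfold totalWeight
    refine Finset.sum_congr ?_ fun f hf => ?_
    · ext f; simp [hg]
    · by_cases hfe : f = e
      · subst hfe; simp
      · rw [if_neg hfe, add_zero, hw f (by simpa [hg] using (Finset.mem_filter.1 hf).1) hfe]
  rw [h1, Finset.sum_add_distrib, Finset.sum_ite_eq']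
  congr 1
  refine if_congr ?_ rfl rfl
  simp only [Finset.mem_filter, Set.Finite.mem_toFinset, he.edge_mem, true_and]
  rw [he.isLink_iff]
  tauto

theorem EdgeAdded.exists_totalWeight [DecidableEq V] {G' : WeightedMultigraph V β} {k t : V}
    (h : G.EdgeAdded G' k t) : ∃ δ, 0 < δ ∧ ∀ x y, G'.totalWeight x y =
      G.totalWeight x y + if (x = k ∧ y = t) ∨ (x = t ∧ y = k) then δ else 0 := by
  classical
  obtain ⟨e, he, hl, hw⟩ := h
  have hekt : G'.graph.IsLink e k t := (hl e k t).2 (Or.inr ⟨rfl, Or.inl ⟨rfl, rfl⟩⟩)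
  refine ⟨G'.weight e, G'.weight_pos e hekt.edge_mem, fun x y => ?_⟩
  unfold totalWeight
  have hnot : e ∉ ({f ∈ G.edgeSet_finite.toFinset | G.graph.IsLink f x y} : Finset β) := by
    simp [he]
  have hsum : ∑ f ∈ G.edgeSet_finite.toFinset with G.graph.IsLink f x y, G'.weight f =
      ∑ f ∈ G.edgeSet_finite.toFinset with G.graph.IsLink f x y, G.weight f :=
    Finset.sum_congr rfl fun f hf => hw f (by simpa using (Finset.mem_filter.1 hf).1)
  split_ifs with hxy
  · rw [← hsum, add_comm, ← Finset.sum_insert hnot]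
    refine Finset.sum_congr ?_ fun _ _ => rfl
    ext f
    simp only [Finset.mem_filter, Set.Finite.mem_toFinset, Finset.mem_insert]
    constructor
    · rintro ⟨-, h2⟩
      rcases (hl f x y).1 h2 with h3 | h3
      · exact Or.inr ⟨h3.edge_mem, h3⟩
      · exact Or.inl h3.1
    · rintro (rfl | ⟨-, h3⟩)
      · exact ⟨hekt.edge_mem, (hl _ _ _).2 (Or.inr ⟨rfl, hxy⟩)⟩
      · exact ⟨((hl _ _ _).2 (Or.inl h3)).edge_mem, (hl _ _ _).2 (Or.inl h3)⟩
  · rw [← hsum, add_zero]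
    refine Finset.sum_congr ?_ fun _ _ => rfl
    ext f
    simp only [Finset.mem_filter, Set.Finite.mem_toFinset]
    have hiff : G'.graph.IsLink f x y ↔ G.graph.IsLink f x y := by rw [hl]; tauto
    rw [hiff]
    constructor
    · rintro ⟨-, h⟩; exact ⟨h.edge_mem, h⟩
    · rintro ⟨-, h⟩; exact ⟨(hiff.2 h).edge_mem, h⟩

theorem ModifiedInside.totalWeight_eq {G' : WeightedMultigraph V β} {D : Set V}
    (h : G.ModifiedInside G' D) {x y : V} (hxy : ¬ (x ∈ D ∧ y ∈ D)) :
    G'.totalWeight x y = G.totalWeight x y := by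
  classical
  obtain ⟨h1, h2, h3⟩ := h
  unfold totalWeight
  have hiff : ∀ e, G'.graph.IsLink e x y ↔ G.graph.IsLink e x y := by
    refine fun e => ⟨fun he => ?_, h1 e x y⟩
    by_cases hm : e ∈ G.graph.edgeSet
    · obtain ⟨u, v, huv⟩ := G.graph.exists_isLink_of_mem_edgeSet hm
      rcases (h1 e u v huv).isLink_iff.1 he with ⟨rfl, rfl⟩ | ⟨rfl, rfl⟩
      · exact huv
      · exact huv.symm
    · exact absurd (h2 e x y he hm) hxy
  refine Finset.sum_congr ?_ fun e he => h3 e x y (Finset.mem_filter.1 he).2 hxy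
  ext e
  simp only [Finset.mem_filter, Set.Finite.mem_toFinset, hiff]
  exact and_congr_left fun he => ⟨fun _ => he.edge_mem, fun _ => ((hiff e).2 he).edge_mem⟩

/-- If `p u > 0`, then `-(p u * p v) ≤ -(p u * p t) ≤ -(p k * p t)`, with a strict step unless `u =
k` and `v = t`. If neither factor is positive, the left side is at most `0`. -/
theorem neg_mul_lt_neg_mul_of_extremes {p : V → ℝ} {k t : V} (hk : 0 < p k) (ht : p t < 0)
    (hmax : ∀ x, x ≠ k → p x < p k) (hmin : ∀ x, x ≠ t → p t < p x) {i j : V}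
    (hij : ({i, j} : Set V) ≠ {k, t}) : -(p i * p j) < -(p k * p t) := by
  have hmax' : ∀ x, p x ≤ p k := fun x => by
    by_cases h : x = k
    · rw [h]
    · exact (hmax x h).le
  have hmin' : ∀ x, p t ≤ p x := fun x => by
    by_cases h : x = t
    · rw [h]
    · exact (hmin x h).le
  have aux : ∀ u v, ({u, v} : Set V) ≠ {k, t} → 0 < p u → -(p u * p v) < -(p k * p t) := by
    intro u v huv hu
    by_cases hv : v = t
    · have huk : u ≠ k := by rintro rfl; exact huv (by rw [hv])
      rw [hv]
      nlinarith [hmax u huk]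
    · nlinarith [hmin v hv, hmax' u]
  rcases lt_trichotomy (p i) 0 with hi | hi | hi
  · rcases le_or_gt (p j) 0 with hj | hj
    · nlinarith [mul_pos hk (neg_pos.2 ht), mul_nonneg (neg_nonneg.2 hi.le) (neg_nonneg.2 hj)]
    · rw [mul_comm (p i)]
      exact aux j i (by rwa [Set.pair_comm]) hj
  · rw [hi]; nlinarith
  · exact aux i j hij hi

end Graphs

/-! ### The maximum principle for `I + L` -/

section Matrices

variable {V β : Type*} [Fintype V] [DecidableEq V] (G : WeightedMultigraph V β)

theorem one_add_laplacian_mulVec (f : V → ℝ) (i : V) :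
    ((1 + G.laplacian).mulVec f) i = f i + ∑ x, G.totalWeight i x * (f i - f x) := by
  rw [Matrix.add_mulVec, Matrix.one_mulVec, Pi.add_apply]
  congr 1
  rw [Matrix.mulVec, dotProduct, ← Finset.add_sum_erase _ _ (Finset.mem_univ i),
    ← Finset.add_sum_erase _ (fun x => G.totalWeight i x * (f i - f x)) (Finset.mem_univ i)]
  simp only [laplacian, Matrix.of_apply, if_true, sub_self, mul_zero, zero_add]
  rw [Finset.sum_mul, ← Finset.sum_add_distrib]
  refine Finset.sum_congr rfl fun x hx => ?_
  rw [if_neg (Finset.ne_of_mem_erase hx).symm]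
  ring

variable {G}

/-- A local maximum principle for `I + L`. -/
theorem nonpos_of_local_max {f : V → ℝ} {m : V} (hm : ((1 + G.laplacian).mulVec f) m ≤ 0)
    (hmax : ∀ e x, G.graph.IsLink e m x → f x ≤ f m) : f m ≤ 0 := by
  rw [one_add_laplacian_mulVec] at hm
  have : 0 ≤ ∑ x, G.totalWeight m x * (f m - f x) := by
    refine Finset.sum_nonneg fun x _ => ?_
    by_cases h : G.totalWeight m x = 0
    · simp [h]
    · obtain ⟨e, he⟩ := exists_isLink h
      exact mul_nonneg (G.totalWeight_nonneg m x) (sub_nonneg.2 (hmax e x he))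
  linarith

/-- A maximum principle for `I + L` on a set `S` of vertices. -/
theorem nonpos_on {f : V → ℝ} {S : Set V} {t : V} (ht : t ∈ S)
    (hS : ∀ m ∈ S, ((1 + G.laplacian).mulVec f) m ≤ 0)
    (hbd : ∀ m ∈ S, ∀ e x, G.graph.IsLink e m x → x ∈ S ∨ f x ≤ f t) : f t ≤ 0 := by
  obtain ⟨m, hm, hmax⟩ := Set.exists_max_image S f S.toFinite ⟨t, ht⟩
  refine (hmax t ht).trans (nonpos_of_local_max (hS m hm) fun e x hx => ?_)
  rcases hbd m hm e x hx with h | h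
  · exact hmax x h
  · exact h.trans (hmax t ht)

theorem nonneg_of_mulVec_nonneg {f : V → ℝ} (h : ∀ i, 0 ≤ ((1 + G.laplacian).mulVec f) i)
    (i : V) : 0 ≤ f i := by
  have := nonpos_on (G := G) (f := -f) (S := Set.univ) (t := i) trivial
    (fun m _ => by rw [Matrix.mulVec_neg]; simpa using h m) (fun _ _ _ _ _ => Or.inl trivial)
  simpa using this

/-- The value of a function at a vertex `i` dominates all other values strictly if it is positive
and `(I + L) f` is nonpositive off `i`. -/
theorem lt_of_mulVec_nonpos {f : V → ℝ} {i : V} (hi : 0 < f i)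
    (h : ∀ m, m ≠ i → ((1 + G.laplacian).mulVec f) m ≤ 0) {x : V} (hx : x ≠ i) : f x < f i := by
  by_contra! hc
  -- The only exit from `{i}ᶜ` is `i`, where `f i ≤ f x` by `hc`; the resulting `f x ≤ 0`
  -- contradicts `hi`.
  have := nonpos_on (G := G) (f := f) (S := {i}ᶜ) (t := x) hx (fun m hm => h m hm)
    (fun m _ e y _ => by
      by_cases hy : y = i
      · right; rwa [hy]
      · left; exact hy)
  linarith

/-! ### Invertibility and the columns of `P` -/

variable (G)

theorem isUnit_one_add_laplacian : IsUnit (1 + G.laplacian) := by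
  rw [← Matrix.mulVec_injective_iff_isUnit]
  intro f g hfg
  have h : (1 + G.laplacian).mulVec (f - g) = 0 := by
    rw [Matrix.mulVec_sub]; exact sub_eq_zero.2 hfg
  have h' : (1 + G.laplacian).mulVec (g - f) = 0 := by
    rw [Matrix.mulVec_sub]; exact sub_eq_zero.2 hfg.symm
  funext i
  have h1 := nonneg_of_mulVec_nonneg (G := G) (f := f - g) (fun i => by rw [h]; exact le_rfl) i
  have h2 := nonneg_of_mulVec_nonneg (G := G) (f := g - f) (fun i => by rw [h']; exact le_rfl) i
  simp only [Pi.sub_apply, sub_nonneg] at h1 h2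
  exact le_antisymm h2 h1

theorem mul_forestAccess : (1 + G.laplacian) * G.forestAccess = 1 :=
  Matrix.mul_nonsing_inv _ ((Matrix.isUnit_iff_isUnit_det _).1 G.isUnit_one_add_laplacian)

theorem forestAccess_mul : G.forestAccess * (1 + G.laplacian) = 1 :=
  Matrix.nonsing_inv_mul _ ((Matrix.isUnit_iff_isUnit_det _).1 G.isUnit_one_add_laplacian)

theorem laplacian_isSymm : G.laplacian.IsSymm := by
  refine Matrix.IsSymm.ext fun i j => ?_
  by_cases h : i = j
  · rw [h]
  · simp [laplacian, h, Ne.symm h, G.totalWeight_comm i j]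

theorem forestAccess_isSymm : G.forestAccess.IsSymm := by
  rw [Matrix.IsSymm, forestAccess, Matrix.transpose_nonsing_inv, Matrix.transpose_add,
    Matrix.transpose_one, G.laplacian_isSymm]

theorem forestAccess_comm (i j : V) : G.forestAccess i j = G.forestAccess j i :=
  G.forestAccess_isSymm.apply j i

theorem mulVec_forestAccess_col (j : V) :
    (1 + G.laplacian).mulVec (fun x => G.forestAccess x j) = Pi.single j 1 := by
  have : (fun x => G.forestAccess x j) = G.forestAccess.mulVec (Pi.single j 1) := by
    ext x; simp
  rw [this, Matrix.mulVec_mulVec, mul_forestAccess, Matrix.one_mulVec]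

variable {G}

/-- Identifies columns for a modified graph by exhibiting a solution. -/
theorem eq_forestAccess_col {f : V → ℝ} {j : V}
    (h : (1 + G.laplacian).mulVec f = Pi.single j 1) (i : V) : f i = G.forestAccess i j := by
  have := congrArg (G.forestAccess.mulVec) h
  rw [Matrix.mulVec_mulVec, forestAccess_mul, Matrix.one_mulVec] at this
  rw [this]; simp

variable (G)

theorem forestAccess_nonneg (i j : V) : 0 ≤ G.forestAccess i j := by
  refine nonneg_of_mulVec_nonneg (G := G) (f := fun x => G.forestAccess x j) (fun m => ?_) i
  rw [mulVec_forestAccess_col, Pi.single_apply]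
  split_ifs <;> norm_num

variable {G}

theorem mulVec_forestAccess_col_of_ne {m j : V} (h : m ≠ j) :
    ((1 + G.laplacian).mulVec (fun x => G.forestAccess x j)) m = 0 := by
  rw [mulVec_forestAccess_col, Pi.single_apply, if_neg h]

variable (G)

theorem forestAccess_self_pos (j : V) : 0 < G.forestAccess j j := by
  by_contra! hc
  have h := G.one_add_laplacian_mulVec (fun x => G.forestAccess x j) j
  have h0 := le_antisymm hc (G.forestAccess_nonneg j j)
  rw [mulVec_forestAccess_col, Pi.single_eq_same, h0] at h
  have : ∑ x, G.totalWeight j x * (0 - G.forestAccess x j) ≤ 0 :=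
    Finset.sum_nonpos fun x _ => mul_nonpos_of_nonneg_of_nonpos (G.totalWeight_nonneg j x)
      (by linarith [G.forestAccess_nonneg x j])
  linarith

/-! ### Inequalities between entries of `P` -/

variable {G}

theorem forestAccess_lt_self' {i j : V} (h : i ≠ j) : G.forestAccess i j < G.forestAccess j j :=
  lt_of_mulVec_nonpos (G := G) (f := fun x => G.forestAccess x j) (G.forestAccess_self_pos j)
    (fun _ hm => (mulVec_forestAccess_col_of_ne hm).le) h

theorem forestAccess_lt_self {i j : V} (h : i ≠ j) : G.forestAccess i j < G.forestAccess i i := by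
  rw [G.forestAccess_comm i j]; exact forestAccess_lt_self' h.symm

variable (G)

theorem mulVec_forestAccess_col_sub (i k : V) :
    (1 + G.laplacian).mulVec (fun x => G.forestAccess x i - G.forestAccess x k) =
      Pi.single i 1 - Pi.single k 1 := by
  rw [← mulVec_forestAccess_col, ← mulVec_forestAccess_col, ← Matrix.mulVec_sub]
  rfl

variable {G}

theorem forestAccess_sub_lt {i k x : V} (hik : i ≠ k) (hx : x ≠ i) :
    G.forestAccess x i - G.forestAccess x k < G.forestAccess i i - G.forestAccess i k := by
  refine lt_of_mulVec_nonpos (G := G) (f := fun x => G.forestAccess x i - G.forestAccess x k)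
    (sub_pos.2 (forestAccess_lt_self hik)) (fun m hm => ?_) hx
  rw [mulVec_forestAccess_col_sub, Pi.sub_apply, Pi.single_apply, Pi.single_apply, if_neg hm]
  split_ifs <;> norm_num

theorem forestAccess_triangle (i j k : V) :
    G.forestAccess i j + G.forestAccess i k - G.forestAccess j k ≤ G.forestAccess i i := by
  by_cases hik : i = k
  · subst hik; linarith [G.forestAccess_comm i j]
  by_cases hj : j = i
  · subst hj; linarith
  linarith [forestAccess_sub_lt (G := G) hik hj, G.forestAccess_comm i j]

/-- Positivity spreads along edges: at a zero other than `j` of the nonnegative column `j`, the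
equation forces the weighted sum of neighbouring values to vanish. -/
theorem forestAccess_pos_of_isWalk {i j : V} {l : List V} (h : G.IsWalk i j l) :
    0 < G.forestAccess i j := by
  induction h with
  | nil i => exact G.forestAccess_self_pos i
  | @cons e i y j l he h ih =>
    by_contra! hc
    have h0 := le_antisymm hc (G.forestAccess_nonneg i j)
    have hij : i ≠ j := by
      rintro rfl
      exact (G.forestAccess_self_pos i).ne' h0
    have h1 := G.one_add_laplacian_mulVec (fun x => G.forestAccess x j) i
    rw [mulVec_forestAccess_col_of_ne hij, h0, zero_add] at h1
    have h2 : 0 < ∑ x, G.totalWeight i x * G.forestAccess x j :=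
      Finset.sum_pos' (fun x _ => mul_nonneg (G.totalWeight_nonneg i x)
        (G.forestAccess_nonneg x j)) ⟨y, Finset.mem_univ y, mul_pos (totalWeight_pos he) ih⟩
    simp only [zero_sub, mul_neg, Finset.sum_neg_distrib] at h1
    linarith

theorem forestAccess_eq_zero_iff (i j : V) :
    G.forestAccess i j = 0 ↔ ¬ ∃ l, G.IsPath i j l := by
  constructor
  · rintro h ⟨l, hl, -⟩
    exact (forestAccess_pos_of_isWalk hl).ne' h
  · intro h
    refine le_antisymm ?_ (G.forestAccess_nonneg i j)
    -- The vertices with no walk to `j` exclude `j` and are closed under adjacency.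
    refine nonpos_on (G := G) (f := fun x => G.forestAccess x j)
      (S := {x | ¬ ∃ l, G.IsWalk x j l}) (t := i) ?_ ?_ ?_
    · rintro ⟨l, hl⟩
      obtain ⟨l', hl', -⟩ := hl.exists_isPath
      exact h ⟨l', hl'⟩
    · intro m hm
      refine (mulVec_forestAccess_col_of_ne ?_).le
      rintro rfl
      exact hm ⟨_, .nil m⟩
    · rintro m hm e x he
      left
      rintro ⟨l, hl⟩
      exact hm ⟨_, .cons he hl⟩

theorem forestAccess_transit {i k t : V} (hik : ∃ l, G.IsPath i k l) (hkt : k ≠ t)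
    (hne : i ≠ k) (ht : ∀ l, G.IsPath i t l → k ∈ l) :
    G.forestAccess i t < G.forestAccess i k := by
  obtain ⟨l, hl, -⟩ := hik
  have hpos := forestAccess_pos_of_isWalk hl
  by_contra! hc
  rw [G.forestAccess_comm i k, G.forestAccess_comm i t] at hc
  rw [G.forestAccess_comm i k] at hpos
  -- `S` consists of the vertices joined to `t` by a walk avoiding `k`. It misses `i`, and can be
  -- left only through `k`, where the column is at most its value at `t` by `hc`.
  have := nonpos_on (G := G) (f := fun x => G.forestAccess x i)
    (S := {x | ∃ l, G.IsWalk x t l ∧ k ∉ l}) (t := t) ⟨_, .nil t, by simpa using hkt⟩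
    (fun m hm => by
      refine (mulVec_forestAccess_col_of_ne ?_).le
      rintro rfl
      obtain ⟨l, hl, hk⟩ := hm
      obtain ⟨l', hl', hs⟩ := hl.exists_isPath
      exact hk (hs (ht l' hl')))
    (fun m hm e x he => by
      obtain ⟨l, hl, hk⟩ := hm
      by_cases hx : k = x
      · right; rwa [← hx]
      · left
        exact ⟨x :: l, .cons he.symm hl, by simp [hx, hk]⟩)
  linarith

/-- The transit inequality, including the degenerate case `i = k`. -/
theorem forestAccess_sub_pos {i k t : V} (hik : ∃ l, G.IsPath i k l) (hkt : k ≠ t)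
    (ht : ∀ l, G.IsPath i t l → k ∈ l) : 0 < G.forestAccess i k - G.forestAccess i t := by
  rw [sub_pos]
  by_cases h : i = k
  · subst h; exact forestAccess_lt_self hkt
  · exact forestAccess_transit hik hkt h ht

theorem forestAccess_row_sum (i : V) : ∑ j, G.forestAccess i j = 1 := by
  have h : (1 + G.laplacian).mulVec (fun _ => 1) = fun _ => 1 := by
    ext i; rw [one_add_laplacian_mulVec]; simp
  have := congrArg (G.forestAccess.mulVec) h
  rw [Matrix.mulVec_mulVec, forestAccess_mul, Matrix.one_mulVec] at this
  have := congrFun this i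
  simpa [Matrix.mulVec, dotProduct] using this.symm

/-! ### Changes of the graph: rank-one updates and macrovertices -/

/-- Increasing the total weight of one pair of vertices is a rank-one update of `I + L`. -/
theorem forestAccess_update {G' : WeightedMultigraph V β} {k t : V} {δ : ℝ} (hkt : k ≠ t)
    (hδ : 0 < δ)
    (h : ∀ x y, x ≠ y → G'.totalWeight x y =
      G.totalWeight x y + if (x = k ∧ y = t) ∨ (x = t ∧ y = k) then δ else 0) :
    ∃ c, 0 < c ∧ ∀ i j, G'.forestAccess i j - G.forestAccess i j =
      -(c * (G.forestAccess i k - G.forestAccess i t) *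
        (G.forestAccess j k - G.forestAccess j t)) := by
  set p : V → ℝ := fun x => G.forestAccess x k - G.forestAccess x t with hp
  have hk : 0 < p k := sub_pos.2 (forestAccess_lt_self hkt)
  have ht : p t < 0 := sub_neg.2 (forestAccess_lt_self hkt.symm)
  have hr : 0 < 1 + δ * (p k - p t) := by nlinarith
  have hM : ∀ (f : V → ℝ), (1 + G'.laplacian).mulVec f =
      (1 + G.laplacian).mulVec f + (δ * (f k - f t)) • (Pi.single k 1 - Pi.single t 1) := by
    intro f
    ext x
    rw [Pi.add_apply, one_add_laplacian_mulVec, one_add_laplacian_mulVec, add_assoc]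
    congr 1
    have h1 : ∀ y, G'.totalWeight x y * (f x - f y) = G.totalWeight x y * (f x - f y) +
        ((if y = t then (if x = k then δ * (f k - f t) else 0) else 0) +
          (if y = k then (if x = t then δ * (f t - f k) else 0) else 0)) := by
      intro y
      by_cases hxy : x = y
      · subst hxy
        split_ifs <;> simp_all
      · rw [h x y hxy, add_mul]
        congr 1
        split_ifs <;> simp_all
    rw [Finset.sum_congr rfl fun y _ => h1 y, Finset.sum_add_distrib, Finset.sum_add_distrib]
    congr 1
    simp only [Finset.sum_ite_eq', Finset.mem_univ, if_true, Pi.smul_apply, Pi.sub_apply,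
      Pi.single_apply, smul_eq_mul]
    split_ifs <;> first | (exfalso; simp_all; done) | ring
  -- The Sherman–Morrison constant `δ / (1 + δ uᵀ P u)` for `u = e_k - e_t`.
  refine ⟨δ / (1 + δ * (p k - p t)), div_pos hδ hr, fun i j => ?_⟩
  set c := δ / (1 + δ * (p k - p t)) with hc
  have hcr : c * (1 + δ * (p k - p t)) = δ := div_mul_cancel₀ _ hr.ne'
  have key : (1 + G'.laplacian).mulVec
      ((fun x => G.forestAccess x j) - (c * p j) • p) = Pi.single j 1 := by
    rw [hM, Matrix.mulVec_sub, Matrix.mulVec_smul, mulVec_forestAccess_col, hp,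
      mulVec_forestAccess_col_sub, ← hp, sub_add, sub_eq_self, ← sub_smul]
    refine smul_eq_zero_of_left ?_ _
    simp only [Pi.sub_apply, Pi.smul_apply, smul_eq_mul]
    rw [G.forestAccess_comm k j, G.forestAccess_comm t j]
    change c * p j - δ * (G.forestAccess j k - c * p j * p k -
      (G.forestAccess j t - c * p j * p t)) = 0
    have : G.forestAccess j k - G.forestAccess j t = p j := rfl
    linear_combination p j * hcr - δ * this
  have := eq_forestAccess_col key i
  rw [← this]
  simp only [Pi.sub_apply, Pi.smul_apply, smul_eq_mul, hp]
  ring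

theorem forestAccess_monotonicity {G' : WeightedMultigraph V β} {k t : V} (hkt : k ≠ t)
    (h : G.WeightIncreased G' k t ∨ G.EdgeAdded G' k t) :
    ∃ c, 0 < c ∧ ∀ i j, G'.forestAccess i j - G.forestAccess i j =
      -(c * (G.forestAccess i k - G.forestAccess i t) *
        (G.forestAccess j k - G.forestAccess j t)) := by
  obtain ⟨δ, hδ, hw⟩ := h.elim WeightIncreased.exists_totalWeight EdgeAdded.exists_totalWeight
  exact forestAccess_update hkt hδ fun x y _ => hw x y

/-- Compare the equations at a maximum `a` and a minimum `b` of the column on `D`. Terms inside `D`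
are nonnegative at `a` and nonpositive at `b`; outside, the weights agree and `f a ≥ f b`. Both
right-hand sides are `0`, so `f a ≤ f b`. -/
theorem IsMacrovertex.forestAccess_eq {D : Set V} (hD : G.IsMacrovertex D) {i j k : V}
    (hi : i ∈ D) (hj : j ∈ D) (hk : k ∉ D) : G.forestAccess i k = G.forestAccess j k := by
  classical
  set f : V → ℝ := fun x => G.forestAccess x k
  obtain ⟨a, ha, hmax⟩ := Set.exists_max_image D f D.toFinite ⟨i, hi⟩
  obtain ⟨b, hb, hmin⟩ := Set.exists_min_image D f D.toFinite ⟨i, hi⟩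
  have ne_k : ∀ x ∈ D, x ≠ k := fun x hx h => hk (h ▸ hx)
  have h1 := G.one_add_laplacian_mulVec f a
  have h2 := G.one_add_laplacian_mulVec f b
  rw [mulVec_forestAccess_col_of_ne (ne_k a ha)] at h1
  rw [mulVec_forestAccess_col_of_ne (ne_k b hb)] at h2
  have hab : f a ≤ f b := by
    have h3 : 0 ≤ ∑ x, (G.totalWeight a x * (f a - f x) - G.totalWeight b x * (f b - f x)) := by
      refine Finset.sum_nonneg fun x _ => ?_
      by_cases hx : x ∈ D
      · have := mul_nonneg (G.totalWeight_nonneg a x) (sub_nonneg.2 (hmax x hx))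
        have := mul_nonneg (G.totalWeight_nonneg b x) (sub_nonneg.2 (hmin x hx))
        linarith
      · rw [hD a ha b hb x hx]
        have := mul_nonneg (G.totalWeight_nonneg b x) (sub_nonneg.2 (hmax b hb))
        linarith
    rw [Finset.sum_sub_distrib] at h3
    linarith
  exact le_antisymm ((hmax i hi).trans (hab.trans (hmin j hj)))
    ((hmax j hj).trans (hab.trans (hmin i hi)))

theorem IsMacrovertex.forestAccess_modified {D : Set V} (hD : G.IsMacrovertex D)
    {G' : WeightedMultigraph V β} (h : G.ModifiedInside G' D) (i : V) {k : V} (hk : k ∉ D) :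
    G'.forestAccess i k = G.forestAccess i k := by
  refine (eq_forestAccess_col (G := G') (f := fun x => G.forestAccess x k) ?_ i).symm
  rw [← mulVec_forestAccess_col G]
  ext x
  rw [one_add_laplacian_mulVec, one_add_laplacian_mulVec]
  congr 1
  refine Finset.sum_congr rfl fun y _ => ?_
  by_cases hxy : x ∈ D ∧ y ∈ D
  · simp [hD.forestAccess_eq hxy.1 hxy.2 hk]
  · rw [h.totalWeight_eq hxy]

end Matrices

end WeightedMultigraph

theorem proposition5 {V β : Type*} [Fintype V] [DecidableEq V] (G : WeightedMultigraph V β) :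
    -- existence of the matrix of relative forest accessibilities
    IsUnit (1 + G.laplacian) ∧
    -- symmetry
    G.forestAccess.IsSymm ∧
    -- nonnegativity
    (∀ i j, 0 ≤ G.forestAccess i j) ∧
    -- diagonal maximality
    (∀ i j, i ≠ j → G.forestAccess i j < G.forestAccess i i ∧
      G.forestAccess j i < G.forestAccess i i) ∧
    -- triangle inequality for proximities
    ((∀ i j k, G.forestAccess i j + G.forestAccess i k - G.forestAccess j k ≤
        G.forestAccess i i) ∧
      (∀ i j k, j = k → i ≠ j →
        G.forestAccess i j + G.forestAccess i k - G.forestAccess j k < G.forestAccess i i)) ∧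
    -- disconnection condition
    (∀ i j, G.forestAccess i j = 0 ↔ ¬ ∃ l, G.IsPath i j l) ∧
    -- transit property
    (∀ i k t, (∃ l, G.IsPath i k l) → i ≠ k → k ≠ t → (∀ l, G.IsPath i t l → k ∈ l) →
      G.forestAccess i t < G.forestAccess i k) ∧
    -- monotonicity
    (∀ (G' : WeightedMultigraph V β) (k t : V), k ≠ t →
      (G.WeightIncreased G' k t ∨ G.EdgeAdded G' k t) →
      -- item 1
      (0 < G'.forestAccess k t - G.forestAccess k t ∧
        ∀ i j, ({i, j} : Set V) ≠ {k, t} →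
          G'.forestAccess i j - G.forestAccess i j <
            G'.forestAccess k t - G.forestAccess k t) ∧
      -- item 2
      (∀ i, (∃ l, G.IsPath i k l) → (∀ l, G.IsPath i t l → k ∈ l) →
        G'.forestAccess i k - G.forestAccess i k <
          G'.forestAccess i t - G.forestAccess i t) ∧
      -- item 3
      (∀ i₁ i₂, (∃ l, G.IsPath i₁ k l) → (∀ l, G.IsPath i₁ t l → k ∈ l) →
        (∃ l, G.IsPath i₂ k l) → (∀ l, G.IsPath i₂ t l → k ∈ l) →
        G'.forestAccess i₁ i₂ ≤ G.forestAccess i₁ i₂)) ∧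
    -- doubly stochastic normalization
    ((∀ i j, 0 ≤ G.forestAccess i j) ∧
      (∀ i, ∑ j, G.forestAccess i j = 1) ∧ (∀ i, ∑ j, G.forestAccess j i = 1)) ∧
    -- macrovertex independence
    (∀ D : Set V, G.IsMacrovertex D → ∀ i ∈ D, ∀ j ∈ D, ∀ k ∉ D,
      G.forestAccess i k = G.forestAccess j k ∧
      ∀ G' : WeightedMultigraph V β, G.ModifiedInside G' D →
        G'.forestAccess i k = G.forestAccess i k) := by
  open WeightedMultigraph in
  refine ⟨G.isUnit_one_add_laplacian, G.forestAccess_isSymm, G.forestAccess_nonneg,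
    fun i j h => ⟨forestAccess_lt_self h, forestAccess_lt_self' h.symm⟩,
    ⟨forestAccess_triangle, ?_⟩, forestAccess_eq_zero_iff,
    fun i k t h1 h2 h3 h4 => forestAccess_transit h1 h3 h2 h4, ?_,
    ⟨G.forestAccess_nonneg, forestAccess_row_sum, fun i => ?_⟩,
    fun D hD i hi j hj k hk => ⟨hD.forestAccess_eq hi hj hk,
      fun G' hG' => hD.forestAccess_modified hG' i hk⟩⟩
  · rintro i j k rfl h
    linarith [forestAccess_lt_self (G := G) h, forestAccess_lt_self' (G := G) h]
  · intro G' k t hkt h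
    obtain ⟨c, hc, hΔ⟩ := forestAccess_monotonicity hkt h
    have hk : 0 < G.forestAccess k k - G.forestAccess k t := sub_pos.2 (forestAccess_lt_self hkt)
    have ht : G.forestAccess t k - G.forestAccess t t < 0 :=
      sub_neg.2 (forestAccess_lt_self hkt.symm)
    refine ⟨⟨?_, fun i j hij => ?_⟩, fun i h1 h2 => ?_, fun i₁ i₂ h1 h2 h3 h4 => ?_⟩
    · rw [hΔ]
      nlinarith [mul_neg_of_pos_of_neg (mul_pos hc hk) ht]
    · rw [hΔ, hΔ]
      have := neg_mul_lt_neg_mul_of_extremes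
        (p := fun x => G.forestAccess x k - G.forestAccess x t) hk ht
        (fun x hx => forestAccess_sub_lt hkt hx)
        -- Exchanging `k` and `t` negates `p`, turning the maximum at `k` into the minimum at `t`.
        (fun x hx => by
          have := forestAccess_sub_lt (G := G) hkt.symm hx
          linarith) hij
      have := mul_lt_mul_of_pos_left this hc
      linarith
    · rw [hΔ, hΔ]
      -- `Δp_{it} - Δp_{ik} = c * p i * (p k - p t)`, where `p i > 0` by transit.
      have := mul_pos (mul_pos hc (forestAccess_sub_pos h1 hkt h2)) (sub_pos.2 (ht.trans hk))
      linarith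
    · have := mul_pos (mul_pos hc (forestAccess_sub_pos h1 hkt h2))
        (forestAccess_sub_pos h3 hkt h4)
      linarith [hΔ i₁ i₂]
  · rw [← forestAccess_row_sum (G := G) i]
    exact Finset.sum_congr rfl fun j _ => G.forestAccess_comm j i
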